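/- Let $R$ be an associative ring with identity, not necessarily commutative. Let $U(R)$ be its set of units and $J(R)$ its Jacobson radical, and put $\Delta(R)=\{r\in R : r+u\in U(R)\text{ for all }u\in U(R)\}$. Call $R$ - exchange if for every $a\in R$ there is an idempotent $e\in aR$ with $1-e\in(1-a)R$; - clean if every element of $R$ is the sum of an idempotent and a unit; - $W\Delta U$ (weakly $\Delta U$) if $U(R)=\pm1+\Delta(R)$, that is, if the units of $R$ are exactly the elements $1+d$ and $-1+d$ with $d\in\Delta(R)$; - weakly $\Delta$-clean if every element of $R$ has the form $d+e$ or $d-e$ with $d\in\Delta(R)$ and $e\in R$ idempotent. Then the following four conditions are equivalent: (1) $R$ is exchange and $W\Delta U$. (2) $R$ is clean and $W\Delta U$. (3) $R$ is weakly $\Delta$-clean. (4) All idempotents lift modulo $J(R)$ (every idempotent of $R/J(R)$ is the image of an idempotent of $R$), and $R/J(R)\cong B$, or $R/J(R)\cong\mathbb{Z}/3\mathbb{Z}$, or $R/J(R)\cong B\times\mathbb{Z}/3\mathbb{Z}$ as rings, for some Boolean ring $B$. -/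

import Mathlib

universe u

namespace DeltaRing

/-- The set `Δ(R) = {r ∈ R | r + U(R) ⊆ U(R)}`, where `U(R)` is the set of units of `R`. -/
def Delta (R : Type*) [Ring R] : Set R :=
  {r | ∀ u : R, IsUnit u → IsUnit (r + u)}

/-- `R` is weakly `ΔU` (a `WΔU`-ring): `U(R) = ±1 + Δ(R)`. -/
def IsWeaklyDeltaU (R : Type*) [Ring R] : Prop :=
  {u : R | IsUnit u} = {x : R | ∃ d ∈ Delta R, x = 1 + d ∨ x = -1 + d}

/-- `R` is exchange: for each `a` there is an idempotent `e ∈ aR` with `1 - e ∈ (1 - a)R`. -/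
def IsExchange (R : Type*) [Ring R] : Prop :=
  ∀ a : R, ∃ e : R, IsIdempotentElem e ∧ (∃ r : R, e = a * r) ∧ ∃ s : R, 1 - e = (1 - a) * s

/-- `R` is clean: each element is the sum of an idempotent and a unit. -/
def IsClean (R : Type*) [Ring R] : Prop :=
  ∀ a : R, ∃ e u : R, IsIdempotentElem e ∧ IsUnit u ∧ a = e + u

/-- `R` is weakly `Δ`-clean: each element is `d + e` or `d - e` for some `d ∈ Δ(R)` and some
idempotent `e`. -/
def IsWeaklyDeltaClean (R : Type*) [Ring R] : Prop :=
  ∀ a : R, ∃ d ∈ Delta R, ∃ e : R, IsIdempotentElem e ∧ (a = d + e ∨ a = d - e)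

/-- All idempotents lift modulo the Jacobson radical: each idempotent of `R ⧸ J(R)` is the class
of an idempotent of `R`. -/
def IdempotentsLiftModJacobson (R : Type*) [Ring R] : Prop :=
  ∀ f : R ⧸ Ring.jacobson R, IsIdempotentElem f →
    ∃ e : R, IsIdempotentElem e ∧ Ideal.Quotient.mk (Ring.jacobson R) e = f

end DeltaRing

namespace DeltaRing

/-! ### Units and the Jacobson radical. -/

section Basic

variable {R : Type*} [Ring R]

/-! Everything passes through `S = R ⧸ J(R)`, since units and membership in `Δ` can be tested modulo
`J(R)`. The pivot is that each `a` in `S` satisfies `a² = a` or `a² = -a`. From (1) or (3), a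
nonzero square-zero element of `S` would give matrix units, incompatible with units in `±1 + Δ`
(`eq_zero_of_sq_eq_zero`). So `S` is reduced, its idempotents are central, and `Δ(S) = 0`; then (3)
makes every element `±` an idempotent, while (1) makes `S` clean with units `±1`. The pivot makes
`S` commutative with `6 = 0`, and splitting off `3` leaves a Boolean ring and at most one `ZMod 3`.
Conversely, lifted idempotents carry the pivot back to `R`. -/

lemma isUnit_of_left_right_inv {a l r : R} (hl : l * a = 1) (hr : a * r = 1) : IsUnit a :=
  ⟨⟨a, r, hr, by rw [← left_inv_eq_right_inv hl hr, hl]⟩, rfl⟩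

lemma isUnit_one_add_mul_comm {a b : R} (h : IsUnit (1 + a * b)) : IsUnit (1 + b * a) := by
  obtain ⟨v, h1, h2⟩ := isUnit_iff_exists.1 h
  refine isUnit_iff_exists.2 ⟨1 - b * v * a, ?_, ?_⟩
  · calc (1 + b * a) * (1 - b * v * a) = 1 + b * a - b * ((1 + a * b) * v) * a := by noncomm_ring
      _ = 1 := by rw [h1]; noncomm_ring
  · calc (1 - b * v * a) * (1 + b * a) = 1 + b * a - b * (v * (1 + a * b)) * a := by noncomm_ring
      _ = 1 := by rw [h2]; noncomm_ring

lemma isUnit_one_add_of_mem_jacobson {j : R} (hj : j ∈ Ring.jacobson R) : IsUnit (1 + j) := by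
  have key : ∀ x ∈ Ring.jacobson R, ∃ z, z * (1 + x) = 1 := by
    intro x hx
    rw [← Ideal.jacobson_bot, Ideal.mem_jacobson_iff] at hx
    obtain ⟨z, hz⟩ := hx 1
    rw [Ideal.mem_bot, mul_one, sub_eq_zero] at hz
    exact ⟨z, by rw [mul_add, mul_one, add_comm, hz]⟩
  obtain ⟨z, hz⟩ := key j hj
  -- The left inverse `z = 1 - z * j` has the same form, so it is left invertible too.
  obtain ⟨w, hw⟩ := key (-(z * j)) (neg_mem (Ideal.mul_mem_left _ _ hj))
  have hzj : 1 + -(z * j) = z := by rw [← hz]; noncomm_ring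
  rw [hzj] at hw
  have : w = 1 + j := left_inv_eq_right_inv hw hz
  exact isUnit_of_left_right_inv hz (this ▸ hw)

lemma eq_zero_of_jacobson_eq_bot (hJ : Ring.jacobson R = ⊥) {x : R}
    (h : ∀ y, IsUnit (1 + y * x)) : x = 0 := by
  rw [← Ideal.mem_bot, ← hJ, ← Ideal.jacobson_bot, Ideal.mem_jacobson_iff]
  intro y
  obtain ⟨v, -, h2⟩ := isUnit_iff_exists.1 (h y)
  refine ⟨v, ?_⟩
  rw [Ideal.mem_bot, sub_eq_zero, ← h2]
  noncomm_ring

lemma isUnit_of_isUnit_mk {a : R} (h : IsUnit (Ideal.Quotient.mk (Ring.jacobson R) a)) :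
    IsUnit a := by
  obtain ⟨b', h1, h2⟩ := isUnit_iff_exists.1 h
  obtain ⟨b, rfl⟩ := Ideal.Quotient.mk_surjective b'
  have key : ∀ x, Ideal.Quotient.mk (Ring.jacobson R) x = 1 → IsUnit x := by
    intro x hx
    have hm : x - 1 ∈ Ring.jacobson R := by
      rw [← Ideal.Quotient.eq_zero_iff_mem, map_sub, hx, map_one, sub_self]
    simpa using isUnit_one_add_of_mem_jacobson hm
  obtain ⟨c, hc, -⟩ := isUnit_iff_exists.1 (key (a * b) (by rw [map_mul, h1]))
  obtain ⟨d, -, hd⟩ := isUnit_iff_exists.1 (key (b * a) (by rw [map_mul, h2]))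
  exact isUnit_of_left_right_inv (l := d * b) (r := b * c) (by rw [mul_assoc, hd])
    (by rw [← mul_assoc, hc])

/-! ### The set `Δ` -/

lemma mem_Delta_of_mk_mem {d : R}
    (h : Ideal.Quotient.mk (Ring.jacobson R) d ∈ Delta (R ⧸ Ring.jacobson R)) : d ∈ Delta R :=
  fun u hu ↦ isUnit_of_isUnit_mk (by rw [map_add]; exact h _ (hu.map _))

lemma mk_mem_Delta {d : R} (h : d ∈ Delta R) :
    Ideal.Quotient.mk (Ring.jacobson R) d ∈ Delta (R ⧸ Ring.jacobson R) := by
  intro v hv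
  obtain ⟨v, rfl⟩ := Ideal.Quotient.mk_surjective v
  rw [← map_add]
  exact (h v (isUnit_of_isUnit_mk hv)).map _

lemma zero_mem_Delta : (0 : R) ∈ Delta R := fun u hu ↦ by rwa [zero_add]

lemma mem_Delta_of_mem_jacobson {d : R} (h : d ∈ Ring.jacobson R) : d ∈ Delta R :=
  mem_Delta_of_mk_mem (by rw [Ideal.Quotient.eq_zero_iff_mem.2 h]; exact zero_mem_Delta)

lemma add_mem_Delta {a b : R} (ha : a ∈ Delta R) (hb : b ∈ Delta R) : a + b ∈ Delta R :=
  fun u hu ↦ by rw [add_assoc]; exact ha _ (hb _ hu)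

lemma neg_mem_Delta {a : R} (ha : a ∈ Delta R) : -a ∈ Delta R :=
  fun u hu ↦ by simpa [add_comm] using (ha _ hu.neg).neg

lemma sub_mem_Delta {a b : R} (ha : a ∈ Delta R) (hb : b ∈ Delta R) : a - b ∈ Delta R := by
  rw [sub_eq_add_neg]; exact add_mem_Delta ha (neg_mem_Delta hb)

lemma unit_mul_mem_Delta {u a : R} (hu : IsUnit u) (ha : a ∈ Delta R) : u * a ∈ Delta R := by
  intro v hv
  obtain ⟨u, rfl⟩ := hu
  have : ↑u * a + v = u * (a + ↑u⁻¹ * v) := by rw [mul_add, Units.mul_inv_cancel_left]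
  rw [this]
  exact u.isUnit.mul (ha _ (u⁻¹.isUnit.mul hv))

lemma mul_unit_mem_Delta {u a : R} (hu : IsUnit u) (ha : a ∈ Delta R) : a * u ∈ Delta R := by
  intro v hv
  obtain ⟨u, rfl⟩ := hu
  have : a * ↑u + v = (a + v * ↑u⁻¹) * u := by rw [add_mul, Units.inv_mul_cancel_right]
  rw [this]
  exact (ha _ (hv.mul u⁻¹.isUnit)).mul u.isUnit

lemma isUnit_one_add_of_sq_eq_zero {x : R} (hx : x * x = 0) : IsUnit (1 + x) :=
  IsNilpotent.isUnit_one_add ⟨2, by rw [pow_two, hx]⟩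

/-- `x = (1 + x) - 1` is a difference of units, and `Δ` absorbs units. -/
lemma sq_zero_mul_mem_Delta {x a : R} (hx : x * x = 0) (ha : a ∈ Delta R) : x * a ∈ Delta R := by
  have := sub_mem_Delta (unit_mul_mem_Delta (isUnit_one_add_of_sq_eq_zero hx) ha) ha
  rwa [add_mul, one_mul, add_sub_cancel_left] at this

lemma mul_sq_zero_mem_Delta {x a : R} (hx : x * x = 0) (ha : a ∈ Delta R) : a * x ∈ Delta R := by
  have := sub_mem_Delta (mul_unit_mem_Delta (isUnit_one_add_of_sq_eq_zero hx) ha) ha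
  rwa [mul_add, mul_one, add_sub_cancel_left] at this

lemma mul_mem_Delta {a b : R} (ha : a ∈ Delta R) (hb : b ∈ Delta R) : a * b ∈ Delta R := by
  have := sub_mem_Delta (unit_mul_mem_Delta (ha 1 isUnit_one) hb) hb
  rwa [add_mul, one_mul, add_sub_cancel_right] at this

lemma eq_zero_of_idempotent_of_mem_Delta {e : R} (he : IsIdempotentElem e) (hd : e ∈ Delta R) :
    e = 0 := by
  have hu : IsUnit (1 - e) := by
    simpa [← sub_eq_add_neg] using (hd (-1) isUnit_one.neg).neg
  have : (1 - e) * e = (1 - e) * 0 := by rw [sub_mul, one_mul, he.eq, sub_self, mul_zero]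
  exact hu.mul_left_cancel this

lemma isUnit_two_mul_sub_one {e : R} (he : IsIdempotentElem e) : IsUnit (2 * e - 1) := by
  have : (2 * e - 1) * (2 * e - 1) = 1 := by
    calc (2 * e - 1) * (2 * e - 1) = 4 * (e * e) - 4 * e + 1 := by noncomm_ring
      _ = 1 := by rw [he.eq]; simp
  exact isUnit_of_left_right_inv this this

/-- In `eR × (1 - e)R`, the element `e * d + v` has the components of `d + v` and of `v`. -/
lemma central_mul_mem_Delta {e d : R} (he : IsIdempotentElem e) (hc : ∀ r, e * r = r * e)
    (hd : d ∈ Delta R) : e * d ∈ Delta R := by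
  intro v hv
  obtain ⟨w, h1, h2⟩ := isUnit_iff_exists.1 (hd v hv)
  obtain ⟨v', h3, h4⟩ := isUnit_iff_exists.1 hv
  have hf : IsIdempotentElem (1 - e) := he.one_sub
  have hfc : ∀ r, (1 - e) * r = r * (1 - e) := fun r ↦ by
    rw [sub_mul, mul_sub, hc, one_mul, mul_one]
  have hef : e * (1 - e) = 0 := by rw [mul_sub, he.eq, mul_one, sub_self]
  have hfe : (1 - e) * e = 0 := by rw [sub_mul, he.eq, one_mul, sub_self]
  have hsplit : e * d + v = e * (d + v) + (1 - e) * v := by noncomm_ring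
  have key : ∀ x y x' y' : R,
      (e * x + (1 - e) * y) * (e * x' + (1 - e) * y') = e * (x * x') + (1 - e) * (y * y') := by
    intro x y x' y'
    calc (e * x + (1 - e) * y) * (e * x' + (1 - e) * y')
        = (e * x) * e * x' + (e * x) * (1 - e) * y' + ((1 - e) * y) * e * x'
            + ((1 - e) * y) * (1 - e) * y' := by
          rw [add_mul, mul_add, mul_add]; simp only [mul_assoc, add_assoc]
      _ = e * (x * x') + (1 - e) * (y * y') := by
          rw [← hc (e * x), ← hfc (e * x), ← hc ((1 - e) * y), ← hfc ((1 - e) * y)]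
          simp only [← mul_assoc, he.eq, hf.eq, hef, hfe, zero_mul, add_zero]
  rw [hsplit]
  refine isUnit_iff_exists.2 ⟨e * w + (1 - e) * v', ?_, ?_⟩
  · rw [key, h1, h3]; noncomm_ring
  · rw [key, h2, h4]; noncomm_ring

/-! ### Semiprimitive rings with enough idempotents -/

/-- If `x y` and `y x` are orthogonal nonzero idempotents with `x² = y² = 0` (so that `R` contains a
corner of `2 × 2` matrices), not all units lie in `±1 + Δ(R)`. -/
lemma eq_zero_of_matrix_units (hW : ∀ u : R, IsUnit u → u - 1 ∈ Delta R ∨ u + 1 ∈ Delta R)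
    {x y : R} (hx : x * x = 0) (hy : y * y = 0) (hxy : x * y * x = x) : x = 0 := by
  have of_mem : x ∈ Delta R → x = 0 := by
    intro hd
    have h0 := eq_zero_of_idempotent_of_mem_Delta
      (show IsIdempotentElem (x * y) by rw [IsIdempotentElem, ← mul_assoc, hxy])
      (mul_sq_zero_mem_Delta hy hd)
    rw [← hxy, h0, zero_mul]
  apply of_mem
  rcases hW _ (isUnit_one_add_of_sq_eq_zero hx) with h | h
  · rwa [add_sub_cancel_left] at h
  · have h3 := sub_mem_Delta (mul_sq_zero_mem_Delta hy h) (sq_zero_mul_mem_Delta hy h)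
    have h4 := neg_mem_Delta (sq_zero_mul_mem_Delta hx h3)
    have : -(x * ((1 + x + 1) * y - y * (1 + x + 1))) = x := by
      calc _ = x * y * x - x * x * y := by noncomm_ring
        _ = x := by rw [hxy, hx, zero_mul, sub_zero]
    rwa [this] at h4

/-- If `aR` has no nonzero idempotent, all `1 - a * r` are right invertible, so `a` lies in the
radical. Otherwise `e = a * r` yields matrix units `e * a` and `(1 - e) * r`. -/
lemma eq_zero_of_sq_eq_zero (hJ : Ring.jacobson R = ⊥)
    (hW : ∀ u : R, IsUnit u → u - 1 ∈ Delta R ∨ u + 1 ∈ Delta R)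
    (hN : ∀ x : R, (∃ e r : R, IsIdempotentElem e ∧ e ≠ 0 ∧ e = x * r) ∨ ∃ s, (1 - x) * s = 1)
    {a : R} (ha : a * a = 0) : a = 0 := by
  by_contra hne
  have hex : ∃ r e : R, IsIdempotentElem e ∧ e ≠ 0 ∧ e = a * r := by
    by_contra! hcon
    have hr : ∀ r, ∃ s, (1 - a * r) * s = 1 := by
      intro r
      rcases hN (a * r) with ⟨e, t, he, h0, h⟩ | h
      · exact absurd (by rw [h, mul_assoc]) (hcon (r * t) e he h0)
      · exact h
    refine hne (eq_zero_of_jacobson_eq_bot hJ fun y ↦ isUnit_one_add_mul_comm ?_)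
    obtain ⟨s, hs⟩ := hr (-y)
    have hs' : 1 - a * (y * s) = s - (1 - a * -y) * s + 1 := by noncomm_ring
    rw [hs, sub_add_cancel] at hs'
    obtain ⟨t, ht⟩ := hr (y * s)
    rw [hs'] at ht
    have h1 : 1 - a * -y = 1 + a * y := by noncomm_ring
    rw [h1] at hs
    have : 1 + a * y = t := left_inv_eq_right_inv hs ht
    exact isUnit_of_left_right_inv (this ▸ ht) hs
  obtain ⟨r', e, he, h0, h'⟩ := hex
  obtain ⟨r, hr⟩ : ∃ r, r = r' * e := ⟨_, rfl⟩
  have har : a * r = e := by rw [hr, ← mul_assoc, ← h', he.eq]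
  have hre : r * e = r := by rw [hr, mul_assoc, he.eq]
  have hae : a * e = 0 := by rw [← har, ← mul_assoc, ha, zero_mul]
  have hea : e * a * e = 0 := by rw [mul_assoc, hae, mul_zero]
  have hxyx : e * a * ((1 - e) * r) = e := by
    calc e * a * ((1 - e) * r) = e * (a * r) - e * a * e * r := by noncomm_ring
      _ = e := by rw [har, hea, zero_mul, sub_zero, he.eq]
  have hx0 := eq_zero_of_matrix_units hW (x := e * a) (y := (1 - e) * r)
    (by rw [← mul_assoc, hea, zero_mul])
    (by
      calc (1 - e) * r * ((1 - e) * r) = (1 - e) * (r * r - r * e * r) := by noncomm_ring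
        _ = 0 := by rw [hre, sub_self, mul_zero])
    (by rw [hxyx, ← mul_assoc, he.eq])
  apply h0
  rw [← hxyx, hx0, zero_mul]

/-- The corner elements `e * r * (1 - e)` and `(1 - e) * r * e` square to zero. -/
lemma idempotent_central (hred : ∀ a : R, a * a = 0 → a = 0) {e : R} (he : IsIdempotentElem e)
    (r : R) : e * r = r * e := by
  have h1 : e * r - e * r * e = 0 := hred _ <| by
    calc (e * r - e * r * e) * (e * r - e * r * e)
        = e * r * e * r - e * r * e * r * e - e * r * (e * e) * r + e * r * (e * e) * r * e := by
          noncomm_ring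
      _ = 0 := by rw [he.eq]; noncomm_ring
  have h2 : r * e - e * r * e = 0 := hred _ <| by
    calc (r * e - e * r * e) * (r * e - e * r * e)
        = r * e * r * e - r * (e * e) * r * e - e * r * e * r * e + e * r * (e * e) * r * e := by
          noncomm_ring
      _ = 0 := by rw [he.eq]; noncomm_ring
  rw [sub_eq_zero.1 h1, sub_eq_zero.1 h2]

/-- In a semiprimitive ring with central idempotents in which each element is an idempotent, up to
sign, plus an element that multiplies `Δ(R)` into itself, `Δ(R) = 0`. -/
lemma eq_zero_of_mem_Delta (hJ : Ring.jacobson R = ⊥)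
    (hc : ∀ e : R, IsIdempotentElem e → ∀ r, e * r = r * e)
    (hdec : ∀ r : R, ∃ t e : R, (∀ d ∈ Delta R, t * d ∈ Delta R) ∧ IsIdempotentElem e ∧
      (r = t + e ∨ r = t - e))
    {d : R} (hd : d ∈ Delta R) : d = 0 := by
  refine eq_zero_of_jacobson_eq_bot hJ fun r ↦ ?_
  obtain ⟨t, e, ht, he, h⟩ := hdec r
  have hed := central_mul_mem_Delta he (hc e he) hd
  have : r * d ∈ Delta R := by
    rcases h with rfl | rfl
    · rw [add_mul]; exact add_mem_Delta (ht d hd) hed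
    · rw [sub_mul]; exact sub_mem_Delta (ht d hd) hed
  rw [add_comm]
  exact this 1 isUnit_one

lemma sq_eq_or_of_isExchange (hJ : Ring.jacobson R = ⊥) (hE : IsExchange R)
    (hW : ∀ u : R, IsUnit u → u - 1 ∈ Delta R ∨ u + 1 ∈ Delta R) (a : R) :
    a * a = a ∨ a * a = -a := by
  have hred : ∀ a : R, a * a = 0 → a = 0 := fun a ↦ by
    refine eq_zero_of_sq_eq_zero hJ hW fun x ↦ ?_
    obtain ⟨e, he, ⟨r, hr⟩, s, hs⟩ := hE x
    by_cases h0 : e = 0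
    · exact Or.inr ⟨s, by rw [← hs, h0, sub_zero]⟩
    · exact Or.inl ⟨e, r, he, h0, hr⟩
  have hc : ∀ e : R, IsIdempotentElem e → ∀ r, e * r = r * e := fun e ↦ idempotent_central hred
  have hdf : ∀ x y : R, x * y = 1 → IsUnit x := by
    intro x y hxy
    have hi : IsIdempotentElem (y * x) := by
      calc y * x * (y * x) = y * (x * y) * x := by noncomm_ring
        _ = y * x := by rw [hxy, mul_one]
    have : y * x = 1 := by
      calc y * x = y * x * (x * y) := by rw [hxy, mul_one]
        _ = x * (y * x) * y := by rw [← hc _ hi x]; noncomm_ring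
        _ = (x * y) * (x * y) := by noncomm_ring
        _ = 1 := by rw [hxy, mul_one]
    exact isUnit_of_left_right_inv this hxy
  have hclean : ∀ a : R, ∃ u e : R, IsUnit u ∧ IsIdempotentElem e ∧ a = u + e := by
    intro a
    obtain ⟨e, he, ⟨r, hr⟩, s, hs⟩ := hE a
    -- On the `e` part invert `a`; on the `1 - e` part invert `-(1 - a)`.
    refine ⟨a - (1 - e), 1 - e, hdf _ (e * r - (1 - e) * s) ?_, he.one_sub, by rw [sub_add_cancel]⟩
    have hef : (1 - e) * e = 0 := by rw [sub_mul, he.eq, one_mul, sub_self]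
    calc (a - (1 - e)) * (e * r - (1 - e) * s)
        = a * e * r - (1 - e) * e * r - a * (1 - e) * s + (1 - e) * (1 - e) * s := by noncomm_ring
      _ = e * (a * r) + (1 - e) * ((1 - a) * s) := by
          rw [hef, ← hc e he a, ← hc _ he.one_sub a, he.one_sub.eq]; noncomm_ring
      _ = 1 := by rw [← hr, ← hs, he.eq, he.one_sub.eq, add_sub_cancel]
  have hD : ∀ d ∈ Delta R, d = 0 := fun d hd ↦ by
    refine eq_zero_of_mem_Delta hJ hc (fun r ↦ ?_) hd
    obtain ⟨u, e, hu, he, h⟩ := hclean r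
    exact ⟨u, e, fun d hd ↦ unit_mul_mem_Delta hu hd, he, Or.inl h⟩
  have hU : ∀ u : R, IsUnit u → u = 1 ∨ u = -1 := fun u hu ↦ by
    rcases hW u hu with h | h
    · exact Or.inl (sub_eq_zero.1 (hD _ h))
    · exact Or.inr (eq_neg_of_add_eq_zero_left (hD _ h))
  have hpm : ∀ a : R, ∃ e : R, IsIdempotentElem e ∧ (a = 1 + e ∨ a = -(1 - e)) := by
    intro a
    obtain ⟨u, e, hu, he, h⟩ := hclean a
    refine ⟨e, he, ?_⟩
    rcases hU u hu with rfl | rfl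
    · exact Or.inl h
    · right; rw [h]; abel
  -- Writing `3` as `1 + e` or `-(1 - e)` makes `2` or `-3` idempotent; both force `12 = 0`.
  have h12 : (12 : R) = 0 := by
    obtain ⟨e, he, h | h⟩ := hpm 3
    · have h2 : e = 2 := by
        rw [← sub_eq_iff_eq_add'] at h
        rw [← h]; norm_num
      rw [h2, IsIdempotentElem] at he
      calc (12 : R) = 6 * (2 * 2 - 2) := by norm_num
        _ = 0 := by rw [he, sub_self, mul_zero]
    · have h4 : 1 - e = -3 := by rw [h, neg_neg]
      have := he.one_sub.eq
      rw [h4] at this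
      calc (12 : R) = -3 * -3 - -3 := by norm_num
        _ = 0 := by rw [this, sub_self]
  have h6 : (6 : R) = 0 := hred _ (by
    calc (6 : R) * 6 = 3 * 12 := by norm_num
      _ = 0 := by rw [h12, mul_zero])
  obtain ⟨e, he, rfl | rfl⟩ := hpm a
  · have hsq : (1 + e) * (1 + e) = 1 + 3 * e := by
      calc (1 + e) * (1 + e) = 1 + 2 * e + e * e := by noncomm_ring
        _ = 1 + 3 * e := by rw [he.eq]; noncomm_ring
    rcases hU _ (isUnit_two_mul_sub_one he) with h | h
    · right
      have h2 : 2 * e = 2 := by rw [sub_eq_iff_eq_add] at h; rw [h]; norm_num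
      rw [hsq, eq_neg_iff_add_eq_zero]
      calc 1 + 3 * e + (1 + e) = 1 + 1 + 2 * (2 * e) := by noncomm_ring
        _ = 0 := by rw [h2, ← h6]; norm_num
    · left
      have h2 : 2 * e = 0 := by simpa [sub_eq_iff_eq_add] using h
      rw [hsq]
      calc 1 + 3 * e = 1 + e + 2 * e := by noncomm_ring
        _ = 1 + e := by rw [h2, add_zero]
  · right
    rw [neg_mul_neg, he.one_sub.eq, neg_neg]

/-! ### Clean and weakly `Δ`-clean decompositions. -/

lemma IsWeaklyDeltaClean.sub_one_mem_or_add_one_mem (h : IsWeaklyDeltaClean R) (u : R)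
    (hu : IsUnit u) : u - 1 ∈ Delta R ∨ u + 1 ∈ Delta R := by
  have eq_one : ∀ e : R, IsIdempotentElem e → IsUnit e → e = 1 := fun e he hu ↦
    hu.mul_left_cancel (by rw [he.eq, mul_one])
  obtain ⟨d, hd, e, he, rfl | rfl⟩ := h u
  · have h1 := eq_one e he (by simpa using neg_mem_Delta hd _ hu)
    left; rwa [h1, add_sub_cancel_right]
  · have h1 := eq_one e he (by simpa using (neg_mem_Delta hd _ hu).neg)
    right; rwa [h1, sub_add_cancel]

/-- Conjugate `1 - e` by `u`, using `a * (1 - e) = u * (1 - e)` and `(1 - a) * e = -(u * e)`. The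
conjugacy is recorded to show later that `f ≠ 0`. -/
lemma exists_idempotent_of_clean {a e u : R} (he : IsIdempotentElem e) (hu : IsUnit u)
    (h : a = e + u) : ∃ f v v' : R, IsIdempotentElem f ∧ v * v' = 1 ∧ v' * v = 1 ∧
      f = v * (1 - e) * v' ∧ (∃ r, f = a * r) ∧ ∃ s, 1 - f = (1 - a) * s := by
  obtain ⟨v, h1, h2⟩ := isUnit_iff_exists.1 hu
  have hef : e * (1 - e) = 0 := by rw [mul_sub, he.eq, mul_one, sub_self]
  refine ⟨u * (1 - e) * v, u, v, ?_, h1, h2, rfl, ⟨(1 - e) * v, ?_⟩, -(e * v), ?_⟩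
  · calc u * (1 - e) * v * (u * (1 - e) * v) = u * (1 - e) * (v * u) * (1 - e) * v := by
          simp only [mul_assoc]
      _ = u * ((1 - e) * (1 - e)) * v := by rw [h2, mul_one]; simp only [mul_assoc]
      _ = u * (1 - e) * v := by rw [he.one_sub.eq]
  · rw [← mul_assoc, h, add_mul, hef, zero_add]
  · calc 1 - u * (1 - e) * v = 1 - u * v + u * e * v := by noncomm_ring
      _ = u * e * v := by rw [h1]; noncomm_ring
      _ = -(e * v) + e * e * v + u * e * v := by rw [he.eq]; noncomm_ring
      _ = (1 - a) * -(e * v) := by rw [h]; noncomm_ring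

lemma IsClean.isExchange (h : IsClean R) : IsExchange R := fun a ↦ by
  obtain ⟨e, u, he, hu, ha⟩ := h a
  obtain ⟨f, -, -, hf, -, -, -, hr, hs⟩ := exists_idempotent_of_clean he hu ha
  exact ⟨f, hf, hr, hs⟩

lemma eq_or_eq_neg_of_isWeaklyDeltaClean (hJ : Ring.jacobson R = ⊥) (h : IsWeaklyDeltaClean R) :
    (∀ d ∈ Delta R, d = 0) ∧ ∀ a : R, ∃ e, IsIdempotentElem e ∧ (a = e ∨ a = -e) := by
  have hN : ∀ x : R, (∃ e r : R, IsIdempotentElem e ∧ e ≠ 0 ∧ e = x * r) ∨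
      ∃ s, (1 - x) * s = 1 := by
    intro x
    have key : ∀ d ∈ Delta R, ∀ e : R, IsIdempotentElem e → e ≠ 0 →
        ∃ f r : R, IsIdempotentElem f ∧ f ≠ 0 ∧ f = (d + e) * r := by
      intro d hd e he h0
      -- `d + e = (1 - e) + (d + (2 * e - 1))` is a clean decomposition, so `f` is conjugate to `e`.
      obtain ⟨f, v, v', hf, h1, h2, hfv, ⟨r, hr⟩, -⟩ :=
        exists_idempotent_of_clean (a := d + e) he.one_sub (hd _ (isUnit_two_mul_sub_one he))
          (by noncomm_ring)
      refine ⟨f, r, hf, ?_, hr⟩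
      rintro rfl
      apply h0
      calc e = (v' * v) * (1 - (1 - e)) * (v' * v) := by rw [h2]; noncomm_ring
        _ = v' * (v * (1 - (1 - e)) * v') * v := by simp only [mul_assoc]
        _ = 0 := by rw [← hfv, mul_zero, zero_mul]
    obtain ⟨d, hd, e, he, hx⟩ := h x
    by_cases h0 : e = 0
    · right
      have hxd : x = d := by rcases hx with hx | hx <;> simpa [h0] using hx
      obtain ⟨s, hs, -⟩ := isUnit_iff_exists.1 (neg_mem_Delta hd 1 isUnit_one)
      exact ⟨s, by rw [hxd, ← neg_add_eq_sub, hs]⟩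
    · left
      rcases hx with rfl | rfl
      · obtain ⟨f, r, hf, hf0, hr⟩ := key d hd e he h0
        exact ⟨f, r, hf, hf0, hr⟩
      · obtain ⟨f, r, hf, hf0, hr⟩ := key (-d) (neg_mem_Delta hd) e he h0
        exact ⟨f, -r, hf, hf0, by rw [hr]; noncomm_ring⟩
  have hred : ∀ a : R, a * a = 0 → a = 0 := fun a ↦
    eq_zero_of_sq_eq_zero hJ (IsWeaklyDeltaClean.sub_one_mem_or_add_one_mem h) hN
  have hD : ∀ d ∈ Delta R, d = 0 := fun d hd ↦ by
    refine eq_zero_of_mem_Delta hJ (fun e ↦ idempotent_central hred) (fun r ↦ ?_) hd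
    obtain ⟨t, ht, e, he, hr⟩ := h r
    exact ⟨t, e, fun d hd ↦ mul_mem_Delta ht hd, he, hr⟩
  refine ⟨hD, fun a ↦ ?_⟩
  obtain ⟨d, hd, e, he, ha⟩ := h a
  rw [hD d hd, zero_add, zero_sub] at ha
  exact ⟨e, he, ha⟩

end Basic

/-! ### Rings in which `a² = a` or `a² = -a` for all `a` -/

section Structure

lemma exists_booleanRing_equiv_of_comm {S : Type u} [CommRing S]
    (h : ∀ a : S, a * a = a ∨ a * a = -a) :
    (∃ (B : Type u) (_ : BooleanRing B), Nonempty (S ≃+* B)) ∨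
      ∃ (B : Type u) (_ : BooleanRing B), Nonempty (S ≃+* B × ZMod 3) := by
  have h6 : (6 : S) = 0 := by
    rcases h 2 with h | h
    · linear_combination 3 * h
    · linear_combination h
  -- `1 - 2 * e` squares to `1`, so it is `±1`. This is what limits `ZMod 3` to one copy.
  have idem : ∀ e : S, e * e = e → 2 * e = 0 ∨ 2 * e = 2 := by
    intro e he
    rcases h (1 - 2 * e) with h | h
    · left; linear_combination h - 4 * he
    · right; linear_combination -h + 4 * he
  have htwo : ∀ a : S, 2 * a = 0 ∨ 2 * a = 2 ∨ 2 * a = -2 := by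
    intro a
    rcases h a with h | h
    · rcases idem a h with h | h <;> simp [h]
    · rcases idem (-a) (by linear_combination h) with h | h
      · left; linear_combination -h
      · right; right; linear_combination -h
  by_cases h2 : (2 : S) = 0
  · refine Or.inl ⟨S, { ‹CommRing S› with isIdempotentElem := fun a ↦ ?_ }, ⟨RingEquiv.refl S⟩⟩
    rcases h a with h | h
    · exact h
    · exact h.trans (by linear_combination -a * h2)
  let I : Ideal S := Ideal.span {2}
  let K : Ideal S := Ideal.span {3}
  have hI : Ideal.Quotient.mk I 2 = 0 := Ideal.Quotient.eq_zero_iff_mem.2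
    (Ideal.mem_span_singleton_self _)
  have hK : Ideal.Quotient.mk K 3 = 0 := Ideal.Quotient.eq_zero_iff_mem.2
    (Ideal.mem_span_singleton_self _)
  have hco : IsCoprime I K := by
    rw [Ideal.isCoprime_span_singleton_iff]
    exact ⟨-1, 1, by norm_num⟩
  have hmul : I * K = ⊥ := by
    rw [Ideal.span_singleton_mul_span_singleton, Ideal.span_singleton_eq_bot]
    linear_combination h6
  let hB : BooleanRing (S ⧸ I) :=
    { (inferInstance : CommRing (S ⧸ I)) with
      isIdempotentElem := fun x ↦ by
        obtain ⟨a, rfl⟩ := Ideal.Quotient.mk_surjective x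
        show Ideal.Quotient.mk I a * Ideal.Quotient.mk I a = Ideal.Quotient.mk I a
        rw [← map_mul]
        rcases h a with h | h
        · rw [h]
        · rw [h, show -a = a - 2 * a by ring, map_sub, map_mul, hI, zero_mul, sub_zero] }
  have h3 : (1 : S ⧸ K) ≠ 0 := by
    intro h1
    rw [← map_one (Ideal.Quotient.mk K), Ideal.Quotient.eq_zero_iff_mem,
      Ideal.mem_span_singleton] at h1
    obtain ⟨c, hc⟩ := h1
    exact h2 (by linear_combination 2 * hc + c * h6)
  have : Nontrivial (S ⧸ K) := ⟨1, 0, h3⟩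
  have h30 : (3 : S ⧸ K) = 0 := by rwa [map_ofNat] at hK
  have : CharP (S ⧸ K) 3 := by
    refine (CharP.charP_iff_prime_eq_zero Nat.prime_three).2 (by exact_mod_cast h30)
  let φ : ZMod 3 →+* S ⧸ K := ZMod.castHom dvd_rfl (S ⧸ K)
  have hφ : Function.Bijective φ := by
    refine ⟨φ.injective, fun x ↦ ?_⟩
    obtain ⟨a, rfl⟩ := Ideal.Quotient.mk_surjective x
    -- Modulo `3`, `a = -2 * a`, and `2 * a` takes only the values `0, 2, -2`.
    have ha : Ideal.Quotient.mk K a = -Ideal.Quotient.mk K (2 * a) := by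
      rw [← map_neg, show -(2 * a) = a - 3 * a by ring, map_sub, map_mul, hK, zero_mul, sub_zero]
    rw [ha]
    rcases htwo a with h | h | h <;> rw [h]
    · exact ⟨0, by simp⟩
    · exact ⟨-2, by rw [map_neg, map_ofNat, map_ofNat]⟩
    · exact ⟨2, by rw [map_neg, neg_neg, map_ofNat, map_ofNat]⟩
  exact Or.inr ⟨S ⧸ I, hB, ⟨(RingEquiv.quotientBot S).symm.trans <|
    (Ideal.quotEquivOfEq hmul.symm).trans <| (Ideal.quotientMulEquivQuotientProd I K hco).trans <|
    RingEquiv.prodCongr (RingEquiv.refl _) (RingEquiv.ofBijective φ hφ).symm⟩⟩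

variable {S : Type u} [Ring S]

lemma exists_booleanRing_equiv (h : ∀ a : S, a * a = a ∨ a * a = -a) :
    (∃ (B : Type u) (_ : BooleanRing B), Nonempty (S ≃+* B)) ∨
      ∃ (B : Type u) (_ : BooleanRing B), Nonempty (S ≃+* B × ZMod 3) := by
  have hred : ∀ a : S, a * a = 0 → a = 0 := by
    intro a ha
    rcases h a with h | h
    · rw [← h, ha]
    · rw [← neg_eq_zero, ← h, ha]
  have hc : ∀ a b : S, a * b = b * a := by
    intro a b
    rcases h a with h | h
    · exact idempotent_central hred h b
    · have := idempotent_central hred (e := -a) (by rw [IsIdempotentElem, neg_mul_neg, h]) b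
      simpa using this
  let _ : CommRing S := { ‹Ring S› with mul_comm := hc }
  exact exists_booleanRing_equiv_of_comm h

lemma sq_eq_or_of_booleanRing_equiv
    (h : (∃ (B : Type u) (_ : BooleanRing B), Nonempty (S ≃+* B)) ∨
      Nonempty (S ≃+* ZMod 3) ∨
      ∃ (B : Type u) (_ : BooleanRing B), Nonempty (S ≃+* B × ZMod 3)) (a : S) :
    a * a = a ∨ a * a = -a := by
  have h3 : ∀ x : ZMod 3, x * x = x ∨ x * x = -x := by decide
  rcases h with ⟨B, _, ⟨f⟩⟩ | ⟨⟨f⟩⟩ | ⟨B, _, ⟨f⟩⟩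
  · left
    apply f.injective
    rw [map_mul, BooleanRing.mul_self]
  · rcases h3 (f a) with h | h
    · left; apply f.injective; rw [map_mul, h]
    · right; apply f.injective; rw [map_mul, h, map_neg]
  · rcases h3 (f a).2 with h | h
    · left; apply f.injective; rw [map_mul]
      exact Prod.ext (BooleanRing.mul_self _) h
    · right; apply f.injective; rw [map_mul, map_neg]
      exact Prod.ext ((BooleanRing.mul_self _).trans (BooleanRing.neg_eq _).symm) h

end Structure

/-! ### Passing between `R` and `R ⧸ J(R)`. -/

section Lift

variable {R : Type*} [Ring R]

lemma IsExchange.idempotentsLiftModJacobson (h : IsExchange R) :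
    IdempotentsLiftModJacobson R := by
  intro f hf
  obtain ⟨a, rfl⟩ := Ideal.Quotient.mk_surjective f
  obtain ⟨e, he, ⟨r, hr⟩, s, hs⟩ := h a
  refine ⟨e, he, ?_⟩
  have h0 : Ideal.Quotient.mk (Ring.jacobson R) ((1 - a) * a) = 0 := by
    rw [map_mul, map_sub, map_one, sub_mul, one_mul, hf.eq, sub_self]
  -- Both terms contain the factor `(1 - a) * a`, which vanishes modulo the radical.
  have h1 : e - a = (1 - a) * a * r - (1 - a) * a * s := by
    calc e - a = (1 - a) * e - a * (1 - e) := by noncomm_ring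
      _ = (1 - a) * (a * r) - a * ((1 - a) * s) := by rw [← hr, ← hs]
      _ = _ := by noncomm_ring
  rw [← sub_eq_zero, ← map_sub, h1, map_sub, map_mul _ _ r, map_mul _ _ s, h0, zero_mul, zero_mul, sub_zero]

lemma IsExchange.quotient_jacobson (h : IsExchange R) : IsExchange (R ⧸ Ring.jacobson R) := by
  intro x
  obtain ⟨a, rfl⟩ := Ideal.Quotient.mk_surjective x
  obtain ⟨e, he, ⟨r, hr⟩, s, hs⟩ := h a
  exact ⟨Ideal.Quotient.mk _ e, he.map _, ⟨Ideal.Quotient.mk _ r, by rw [← map_mul, ← hr]⟩,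
    Ideal.Quotient.mk _ s, by rw [← map_one (Ideal.Quotient.mk (Ring.jacobson R)), ← map_sub,
      ← map_sub, ← map_mul, hs]⟩

lemma IsWeaklyDeltaClean.quotient_jacobson (h : IsWeaklyDeltaClean R) :
    IsWeaklyDeltaClean (R ⧸ Ring.jacobson R) := by
  intro x
  obtain ⟨a, rfl⟩ := Ideal.Quotient.mk_surjective x
  obtain ⟨d, hd, e, he, ha⟩ := h a
  refine ⟨Ideal.Quotient.mk _ d, mk_mem_Delta hd, Ideal.Quotient.mk _ e, he.map _, ?_⟩
  rcases ha with rfl | rfl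
  · left; rw [map_add]
  · right; rw [map_sub]

lemma IsWeaklyDeltaU.quotient_jacobson (h : IsWeaklyDeltaU R) (u : R ⧸ Ring.jacobson R)
    (hu : IsUnit u) :
    u - 1 ∈ Delta (R ⧸ Ring.jacobson R) ∨ u + 1 ∈ Delta (R ⧸ Ring.jacobson R) := by
  obtain ⟨v, rfl⟩ := Ideal.Quotient.mk_surjective u
  obtain ⟨d, hd, rfl | rfl⟩ := h.subset (isUnit_of_isUnit_mk hu : v ∈ {u : R | IsUnit u})
  · left; simpa using mk_mem_Delta hd
  · right; simpa using mk_mem_Delta hd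

lemma isWeaklyDeltaU_of_sq (hsq : ∀ a : R ⧸ Ring.jacobson R, a * a = a ∨ a * a = -a) :
    IsWeaklyDeltaU R := by
  ext u
  constructor
  · intro hu
    have hu' : IsUnit (Ideal.Quotient.mk (Ring.jacobson R) u) := IsUnit.map _ hu
    rcases hsq (Ideal.Quotient.mk _ u) with h | h
    · refine ⟨u - 1, mem_Delta_of_mem_jacobson ?_, Or.inl (add_sub_cancel _ _).symm⟩
      have h1 := hu'.mul_left_cancel (h.trans (mul_one _).symm)
      rw [← Ideal.Quotient.eq_zero_iff_mem, map_sub, h1, map_one, sub_self]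
    · refine ⟨u + 1, mem_Delta_of_mem_jacobson ?_, Or.inr (by abel)⟩
      have h1 := hu'.mul_left_cancel (h.trans (mul_neg_one _).symm)
      rw [← Ideal.Quotient.eq_zero_iff_mem, map_add, h1, map_one, neg_add_cancel]
  · rintro ⟨d, hd, rfl | rfl⟩
    · show IsUnit (1 + d)
      rw [add_comm]; exact hd 1 isUnit_one
    · show IsUnit (-1 + d)
      rw [add_comm]; exact hd (-1) isUnit_one.neg

lemma exists_idempotent_mk_eq_or_eq_neg (hL : IdempotentsLiftModJacobson R)
    (hsq : ∀ a : R ⧸ Ring.jacobson R, a * a = a ∨ a * a = -a) (a : R) :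
    ∃ e : R, IsIdempotentElem e ∧
      (Ideal.Quotient.mk (Ring.jacobson R) a = Ideal.Quotient.mk (Ring.jacobson R) e ∨
        Ideal.Quotient.mk (Ring.jacobson R) a = -Ideal.Quotient.mk (Ring.jacobson R) e) := by
  rcases hsq (Ideal.Quotient.mk _ a) with h | h
  · obtain ⟨e, he, h⟩ := hL _ h
    exact ⟨e, he, Or.inl h.symm⟩
  · obtain ⟨e, he, h⟩ := hL (-Ideal.Quotient.mk _ a) (by rw [IsIdempotentElem, neg_mul_neg, h])
    exact ⟨e, he, Or.inr (by rw [h, neg_neg])⟩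

lemma isWeaklyDeltaClean_of_sq (hL : IdempotentsLiftModJacobson R)
    (hsq : ∀ a : R ⧸ Ring.jacobson R, a * a = a ∨ a * a = -a) : IsWeaklyDeltaClean R := by
  intro a
  obtain ⟨e, he, h | h⟩ := exists_idempotent_mk_eq_or_eq_neg hL hsq a
  · refine ⟨a - e, mem_Delta_of_mem_jacobson ?_, e, he, Or.inl (sub_add_cancel _ _).symm⟩
    rw [← Ideal.Quotient.eq_zero_iff_mem, map_sub, h, sub_self]
  · refine ⟨a + e, mem_Delta_of_mem_jacobson ?_, e, he, Or.inr (add_sub_cancel_right _ _).symm⟩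
    rw [← Ideal.Quotient.eq_zero_iff_mem, map_add, h, neg_add_cancel]

/-- Modulo the radical, `a - (1 - e)` is `2 * e - 1` or `-1`, a unit either way. -/
lemma isClean_of_sq (hL : IdempotentsLiftModJacobson R)
    (hsq : ∀ a : R ⧸ Ring.jacobson R, a * a = a ∨ a * a = -a) : IsClean R := by
  intro a
  obtain ⟨e, he, h | h⟩ := exists_idempotent_mk_eq_or_eq_neg hL hsq a
  · refine ⟨1 - e, a - (1 - e), he.one_sub, isUnit_of_isUnit_mk ?_, (add_sub_cancel _ _).symm⟩
    have := (isUnit_two_mul_sub_one he).map (Ideal.Quotient.mk (Ring.jacobson R))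
    convert this using 1
    rw [map_sub, h, ← map_sub]
    congr 1
    noncomm_ring
  · refine ⟨1 - e, a - (1 - e), he.one_sub, isUnit_of_isUnit_mk ?_, (add_sub_cancel _ _).symm⟩
    have : Ideal.Quotient.mk (Ring.jacobson R) (a - (1 - e)) = -1 := by
      rw [map_sub, h, map_sub, map_one]; abel
    rw [this]
    exact isUnit_one.neg

end Lift

end DeltaRing

open DeltaRing in
theorem theorem3 (R : Type u) [Ring R] :
    List.TFAE
      [DeltaRing.IsExchange R ∧ DeltaRing.IsWeaklyDeltaU R,
       DeltaRing.IsClean R ∧ DeltaRing.IsWeaklyDeltaU R,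
       DeltaRing.IsWeaklyDeltaClean R,
       DeltaRing.IdempotentsLiftModJacobson R ∧
        ((∃ (B : Type u) (_ : BooleanRing B), Nonempty ((R ⧸ Ring.jacobson R) ≃+* B)) ∨
          Nonempty ((R ⧸ Ring.jacobson R) ≃+* ZMod 3) ∨
          ∃ (B : Type u) (_ : BooleanRing B),
            Nonempty ((R ⧸ Ring.jacobson R) ≃+* B × ZMod 3))] := by
  have hJ := Ring.jacobson_quotient_jacobson R
  tfae_have 2 → 1 := fun h ↦ ⟨h.1.isExchange, h.2⟩
  tfae_have 1 → 4 := fun ⟨hE, hW⟩ ↦ ⟨hE.idempotentsLiftModJacobson,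
    (exists_booleanRing_equiv
      (sq_eq_or_of_isExchange hJ hE.quotient_jacobson hW.quotient_jacobson)).imp_right Or.inr⟩
  tfae_have 4 → 2 := fun ⟨hL, h⟩ ↦
    ⟨isClean_of_sq hL (sq_eq_or_of_booleanRing_equiv h),
      isWeaklyDeltaU_of_sq (sq_eq_or_of_booleanRing_equiv h)⟩
  tfae_have 4 → 3 := fun ⟨hL, h⟩ ↦
    isWeaklyDeltaClean_of_sq hL (sq_eq_or_of_booleanRing_equiv h)
  tfae_have 3 → 4 := by
    intro h
    obtain ⟨hD, hpm⟩ := eq_or_eq_neg_of_isWeaklyDeltaClean hJ h.quotient_jacobson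
    refine ⟨fun f hf ↦ ?_, (exists_booleanRing_equiv fun a ↦ ?_).imp_right Or.inr⟩
    · obtain ⟨a, rfl⟩ := Ideal.Quotient.mk_surjective f
      obtain ⟨d, hd, e, he, ha⟩ := h a
      refine ⟨e, he, ?_⟩
      have hd0 := hD _ (mk_mem_Delta hd)
      rcases ha with rfl | rfl
      · rw [map_add, hd0, zero_add]
      -- Here `f` is the class of `-e`; being idempotent, it equals its square, the class of `e`.
      · rw [map_sub, hd0, zero_sub] at hf ⊢
        rw [← hf.eq, neg_mul_neg, ← map_mul, he.eq]
    · obtain ⟨e, he, rfl | rfl⟩ := hpm a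
      · exact Or.inl he
      · exact Or.inr (by rw [neg_mul_neg, he.eq, neg_neg])
  tfae_finish
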